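/- Let $H$ be a compact (Hausdorff) group with its normalised Haar measure, $\mathcal H$ a separable complex Hilbert space, and $\mathcal H'=L^2(H,\mathcal H)$ with the action $(hf)(g)=f(h^{-1}g)$ of $H$. Let $\widehat{\mathcal F}_*(\mathcal H')$, with the norm topology, be the space of bounded self-adjoint Fredholm operators on $\mathcal H'$ that commute with every $h\in H$ and whose essential spectrum meets both $(0,\infty)$ and $(-\infty,0)$. For a bounded self-adjoint operator $T$ and a closed set $K\subseteq\mathbb R$ let $\chi_K(T)$ be the spectral projection. A grid $G$ consists of a partition $0=t_0<t_1<\dots<t_n=1$ of $[0,1]$ and, for each $j=1,\dots,n$, a partition $0=y_{j,0}<y_{j,1}<\dots<y_{j,m_j}=a_j$ ($m_j\ge 1$) of a segment $[0,a_j]$; its cells are the rectangles $[t_{j-1},t_j]\times[y_{j,i-1},y_{j,i}]$. Let $B:[0,1]\to\widehat{\mathcal F}_*(\mathcal H')$ be continuous. The grid is nonsingular at its vertices (for $B$) if, for all $j$ and all $i\ge 1$, $y_{j,i}$ lies neither in $\operatorname{spec}B(t_{j-1})$ nor in $\operatorname{spec}B(t_j)$. It is good (for $B$) if it is nonsingular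 at its vertices and, for each $j$, the map $t\mapsto \chi_{[-a_j,a_j]}(B(t))$ is norm continuous on $[t_{j-1},t_j]$ with values of finite rank. A grid $G'$ refines $G$ if every partition point $t_j$ of $G$ is one of $G'$ and, whenever a column of $G'$ lies over a subinterval of $[t_{j-1},t_j]$, its vertical partition is again a partition of $[0,a_j]$ and contains all the points $y_{j,i}$. For $h\in H$ put $$S_h(B,G)=\sum_{j=1}^n\sum_{i=1}^{m_j}\Big[\operatorname{Tr}\big(h|_{\mathbb E_{j,i}(t_j)}\big)-\operatorname{Tr}\big(h|_{\mathbb E_{j,i}(t_{j-1})}\big)\Big],\qquad \mathbb E_{j,i}(t)=\operatorname{im}\chi_{[y_{j,i-1},\,y_{j,i}]}(B(t)).$$ When $m_j=1$ for all $j$ this is $\sum_j[\operatorname{Tr}(h|_{\mathbb E_j(t_j)})-\operatorname{Tr}(h|_{\mathbb E_j(t_{j-1})})]$ with $\mathbb E_j(t)=\operatorname{im}\chi_{[0,a_j]}(B(t))$. The $h$-equivariant spectral flow $\mathrm{sf}_h(B)$ is the number $S_h(B,G)$ for a chosen good grid $G$. Proposition. For every $h\in H$ and every continuous path $B:[0,1]\to\widehat{\mathcal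 F}_*(\mathcal H')$ the $h$-equivariant spectral flow is well defined: (1) a good grid for $B$ exists; (2) it is independent of refinements: if $G$ is good for $B$ and $G'$ is a refinement of $G$ that is nonsingular at its vertices, then $G'$ is good for $B$ and $S_h(B,G')=S_h(B,G)$; (3) it depends only on the path $B$: $S_h(B,G)=\mathrm{sf}_h(B)$ for every grid $G$ that is good for $B$; in particular any two good grids give the same number. -/

import Mathlib

open MeasureTheory TopologicalSpace unitInterval

noncomputable section

namespace EquivSF

/-! ### Spectral subspaces of bounded self-adjoint operators -/

section Spectral

variable {E : Type*} [NormedAddCommGroup E] [InnerProductSpace ℂ E] [CompleteSpace E]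

/-- The spectral subspace of a bounded self-adjoint operator `T` belonging to a closed set `K` of
real numbers, i.e. the range of the spectral projection `χ_K(T)`: the vectors annihilated by `f(T)`
for every continuous function `f` that vanishes on `K` (equivalently, the vectors whose spectral
measure with respect to `T` is supported in `K`). -/
def spectralSubspace (T : E →L[ℂ] E) (K : Set ℝ) : Submodule ℂ E :=
  ⨅ (f : C(ℝ, ℝ)) (_ : Set.EqOn f 0 K), (cfc (f : ℝ → ℝ) T : E →L[ℂ] E).ker

theorem mem_spectralSubspace {T : E →L[ℂ] E} {K : Set ℝ} {x : E} :
    x ∈ spectralSubspace T K ↔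
      ∀ f : C(ℝ, ℝ), Set.EqOn f 0 K → (cfc (f : ℝ → ℝ) T : E →L[ℂ] E) x = 0 := by
  simp [spectralSubspace, Submodule.mem_iInf]

theorem isClosed_spectralSubspace (T : E →L[ℂ] E) (K : Set ℝ) :
    IsClosed (spectralSubspace T K : Set E) := by
  have h : (spectralSubspace T K : Set E) =
      ⋂ (f : C(ℝ, ℝ)) (_ : Set.EqOn f 0 K),
        {x | (cfc (f : ℝ → ℝ) T : E →L[ℂ] E) x = 0} := by
    ext x
    simp [mem_spectralSubspace]
  rw [h]
  exact isClosed_iInter fun f => isClosed_iInter fun _ =>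
    isClosed_eq (ContinuousLinearMap.continuous _) continuous_const

instance (T : E →L[ℂ] E) (K : Set ℝ) : CompleteSpace (spectralSubspace T K) :=
  (isClosed_spectralSubspace T K).completeSpace_coe

/-- The spectral projection `χ_K(T)`, `K` closed. -/
def spectralProj (T : E →L[ℂ] E) (K : Set ℝ) : E →L[ℂ] E :=
  (spectralSubspace T K).starProjection

/-- An operator commuting with `T` preserves the spectral subspaces of `T`. -/
theorem mapsTo_spectralSubspace {T U : E →L[ℂ] E} (hU : Commute T U) (K : Set ℝ) :
    ∀ x ∈ spectralSubspace T K, (U : E →ₗ[ℂ] E) x ∈ spectralSubspace T K := by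
  intro x hx
  rw [mem_spectralSubspace] at hx ⊢
  intro f hf
  have h := congrArg (fun S : E →L[ℂ] E => S x) (hU.cfc_real (f : ℝ → ℝ)).eq
  simp only [mul_apply_eq_comp] at h
  change (cfc (f : ℝ → ℝ) T : E →L[ℂ] E) (U x) = 0
  rw [h, hx f hf, map_zero]

/-- `Tr(U|_V)` for `V` the spectral subspace of `T` belonging to `K`
(meaningful when `V` is finite dimensional). -/
def spectralTrace (T U : E →L[ℂ] E) (hU : Commute T U) (K : Set ℝ) : ℂ :=
  LinearMap.trace ℂ (spectralSubspace T K)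
    ((U : E →ₗ[ℂ] E).restrict (mapsTo_spectralSubspace hU K))

/-- The essential spectrum of a self-adjoint operator, as a set of real numbers. -/
def essSpectrum (T : E →L[ℂ] E) : Set ℝ :=
  {r | ¬ (T - algebraMap ℝ (E →L[ℂ] E) r).IsFredholm}

end Spectral

/-! ### The model `H`-Hilbert space and the equivariant self-adjoint Fredholm operators -/

section Model

variable (H : Type*) [Group H] [TopologicalSpace H] [IsTopologicalGroup H] [CompactSpace H]
  [MeasurableSpace H] [BorelSpace H]
variable (V : Type*) [NormedAddCommGroup V] [InnerProductSpace ℂ V] [CompleteSpace V]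

/-- The Haar measure of total mass one of a compact group. -/
abbrev haarProb : Measure H := Measure.haarMeasure (⊤ : PositiveCompacts H)

/-- The Hilbert space `L²(H, V)`. -/
abbrev HilbL2 : Type _ := Lp V 2 (haarProb H)

variable {H}

/-- The action of `H` on `L²(H, V)` by left translation, `(h f)(g) = f (h⁻¹ g)`. -/
def leftReg (h : H) : HilbL2 H V →L[ℂ] HilbL2 H V :=
  (Lp.compMeasurePreservingₗᵢ ℂ (fun g : H => h⁻¹ * g)
    (measurePreserving_mul_left (haarProb H) h⁻¹)).toContinuousLinearMap

variable (H)

/-- The `H`-equivariant bounded self-adjoint Fredholm operators on `L²(H, V)` whose essential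
spectrum meets both the positive and the negative half-line, with the norm topology. -/
def FredStar : Set (HilbL2 H V →L[ℂ] HilbL2 H V) :=
  {T | IsSelfAdjoint T ∧ T.IsFredholm ∧ (∀ h : H, Commute T (leftReg V h)) ∧
    (essSpectrum T ∩ Set.Ioi 0).Nonempty ∧ (essSpectrum T ∩ Set.Iio 0).Nonempty}

end Model

/-! ### Grid partitions -/

/-- A partition `0 = t₀ < ⋯ < tₙ = 1` of the horizontal axis `[0,1]` together with, over each
column `[t_j, t_{j+1}]`, a partition `0 = y₀ < ⋯ < y_m = a_j`, `m ≥ 1`, of a segment `[0, a_j]` of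
the vertical axis. A column with `m = 1` is a single cell `[t_j, t_{j+1}] × [0, a_j]`. -/
structure Grid where
  /-- number of columns -/
  n : ℕ
  /-- the points of the horizontal partition -/
  t : Fin (n + 1) → I
  t_strictMono : StrictMono t
  t_zero : t 0 = 0
  t_last : t (Fin.last n) = 1
  /-- number of cells in each column -/
  m : Fin n → ℕ
  m_pos : ∀ j, 0 < m j
  /-- the points of the vertical partition over each column -/
  y : ∀ j : Fin n, Fin (m j + 1) → ℝ
  y_strictMono : ∀ j, StrictMono (y j)
  y_zero : ∀ j, y j 0 = 0

namespace Grid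

/-- The height `a_j` of a column. -/
def height (G : Grid) (j : Fin G.n) : ℝ := G.y j (Fin.last (G.m j))

/-- `G'` is a refinement of `G`: it arises from `G` by vertical and horizontal cuts. Every column of
`G'` that lies inside a column of `G` has the same height, and its vertical partition contains
the vertical partition of that column of `G`. -/
def Refines (G' G : Grid) : Prop :=
  Set.range G.t ⊆ Set.range G'.t ∧
  ∀ (j' : Fin G'.n) (j : Fin G.n),
    G.t j.castSucc ≤ G'.t j'.castSucc → G'.t j'.succ ≤ G.t j.succ →
      Set.range (G.y j) ⊆ Set.range (G'.y j') ∧ G'.height j' = G.height j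

variable {H : Type*} [Group H] [TopologicalSpace H] [IsTopologicalGroup H] [CompactSpace H]
  [MeasurableSpace H] [BorelSpace H]
variable {V : Type*} [NormedAddCommGroup V] [InnerProductSpace ℂ V] [CompleteSpace V]

/-- The spectrum of the path misses every vertex `(t, y)`, `y ≠ 0`, of every cell of the grid. -/
def NonsingularAtVertices (G : Grid) (B : C(I, FredStar H V)) : Prop :=
  ∀ (j : Fin G.n) (i : Fin (G.m j + 1)), i ≠ 0 →
    G.y j i ∉ spectrum ℝ (B (G.t j.castSucc) : HilbL2 H V →L[ℂ] HilbL2 H V) ∧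
    G.y j i ∉ spectrum ℝ (B (G.t j.succ) : HilbL2 H V →L[ℂ] HilbL2 H V)

/-- A grid is good for the path `B` if the spectrum of `B` misses its vertices off the horizontal
axis and if, over each column `[t_j, t_{j+1}]`, the spectral projection `χ_{[-a_j, a_j]}(B t)` has
finite rank and depends (norm-)continuously on `t`. -/
def IsGood (G : Grid) (B : C(I, FredStar H V)) : Prop :=
  G.NonsingularAtVertices B ∧
  ∀ j : Fin G.n,
    (∀ t ∈ Set.Icc (G.t j.castSucc) (G.t j.succ),
      FiniteDimensional ℂ (spectralSubspace (B t : HilbL2 H V →L[ℂ] HilbL2 H V)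
        (Set.Icc (-G.height j) (G.height j)))) ∧
    ContinuousOn (fun t => spectralProj (B t : HilbL2 H V →L[ℂ] HilbL2 H V)
        (Set.Icc (-G.height j) (G.height j)))
      (Set.Icc (G.t j.castSucc) (G.t j.succ))

/-- The sum over all cells `[t_j, t_{j+1}] × [y_i, y_{i+1}]` of
`Tr(h|_{𝔼(t_{j+1})}) - Tr(h|_{𝔼(t_j)})`, where `𝔼(t)` is the spectral subspace of `B t` belonging
to `[y_i, y_{i+1}]`. -/
def traceSum (h : H) (B : C(I, FredStar H V)) (G : Grid) : ℂ :=
  ∑ j : Fin G.n, ∑ i : Fin (G.m j),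
    (spectralTrace (B (G.t j.succ) : HilbL2 H V →L[ℂ] HilbL2 H V) (leftReg V h)
        ((B (G.t j.succ)).2.2.2.1 h) (Set.Icc (G.y j i.castSucc) (G.y j i.succ))
      - spectralTrace (B (G.t j.castSucc) : HilbL2 H V →L[ℂ] HilbL2 H V) (leftReg V h)
        ((B (G.t j.castSucc)).2.2.2.1 h) (Set.Icc (G.y j i.castSucc) (G.y j i.succ)))

end Grid

open Classical in
/-- The `h`-equivariant spectral flow of a path: the trace sum over a chosen good grid. -/
def spectralFlow {H : Type*} [Group H] [TopologicalSpace H] [IsTopologicalGroup H]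
    [CompactSpace H] [MeasurableSpace H] [BorelSpace H]
    {V : Type*} [NormedAddCommGroup V] [InnerProductSpace ℂ V] [CompleteSpace V]
    (h : H) (B : C(I, FredStar H V)) : ℂ :=
  if hG : ∃ G : Grid, G.IsGood B then Grid.traceSum h B hG.choose else 0

end EquivSF

end

/-! Over a column the trace on `[0, a]` may jump as eigenvalues cross zero, but for two heights `a ≤
b` these jumps cancel: the difference of the traces is the trace on the subspace of `(a, b]`. Where
the projections of `[-a, a]` and `[-b, b]` are continuous of finite rank, their difference,
multiplied by a continuous cutoff of the operator that is `0` on the negative axis and `1` from `a`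
on, is a continuous family of projections onto that subspace. They commute with `h`, and nearby ones
have `h`-isomorphic ranges, so the difference is constant on connected sets
(`spectralTrace_sub_eq`).

Additivity at nonsingular heights (`spectralTrace_add`) collapses each column to one cell. Two good
grids thus give sums of increments of functions that differ by constants on overlaps of columns, and
such sums agree (`sum_increments_eq`). Both independence claims follow from this comparison.

For existence, a self-adjoint Fredholm operator has finite-dimensional kernel and no other spectrum
near zero, so it has a spectral window stable under small perturbations (`exists_window`). A
Lebesgue number then gives a uniform grid of single-cell columns. -/

noncomputable section

namespace EquivSF

/-! ### Traces on invariant subspaces -/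

section Trace

variable {E : Type*} [AddCommGroup E] [Module ℂ E]

/-- If `A` restricts to a projection of `N` onto `M`, then the trace on `M` of an operator that
preserves both subspaces is the trace on `N` of its product with `A`. -/
theorem trace_restrict_comp_projection {N M : Submodule ℂ E} [FiniteDimensional ℂ N] (hMN : M ≤ N)
    (U A : E →ₗ[ℂ] E) (hN : ∀ x ∈ N, U x ∈ N) (hM : ∀ x ∈ M, U x ∈ M)
    (hA : ∀ x ∈ N, A x ∈ M) (hA' : ∀ x ∈ M, A x = x) :
    LinearMap.trace ℂ M (U.restrict hM) =
      LinearMap.trace ℂ N (U.restrict hN ∘ₗ A.restrict fun x hx => hMN (hA x hx)) := by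
  have : FiniteDimensional ℂ M := Submodule.finiteDimensional_of_le hMN
  let α : N →ₗ[ℂ] M := A.restrict hA
  have h1 : U.restrict hM = α ∘ₗ (U.restrict hN ∘ₗ Submodule.inclusion hMN) := by
    ext x
    simp [α, hA' _ (hM _ x.2)]
  rw [h1, LinearMap.trace_comp_comm', LinearMap.comp_assoc]
  rfl

/-- On `N`, the maps `A` and `id - A` are complementary projections onto `M₁` and `M₂`, so the two
compressed traces add up. -/
theorem trace_restrict_eq_add {N M₁ M₂ : Submodule ℂ E} [FiniteDimensional ℂ N]
    (h₁ : M₁ ≤ N) (h₂ : M₂ ≤ N) (U A : E →ₗ[ℂ] E) (hN : ∀ x ∈ N, U x ∈ N)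
    (hM₁ : ∀ x ∈ M₁, U x ∈ M₁) (hM₂ : ∀ x ∈ M₂, U x ∈ M₂)
    (hA : ∀ x ∈ N, A x ∈ M₁) (hA' : ∀ x ∈ M₁, A x = x)
    (hB : ∀ x ∈ N, x - A x ∈ M₂) (hB' : ∀ x ∈ M₂, A x = 0) :
    LinearMap.trace ℂ N (U.restrict hN) =
      LinearMap.trace ℂ M₁ (U.restrict hM₁) + LinearMap.trace ℂ M₂ (U.restrict hM₂) := by
  rw [trace_restrict_comp_projection h₁ U A hN hM₁ hA hA',
    trace_restrict_comp_projection h₂ U (LinearMap.id - A) hN hM₂ (by simpa using hB)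
      (by simpa using hB'), ← map_add]
  congr 1
  ext x
  simp

end Trace

/-! ### Norm-close projections -/

section Projection

variable {E : Type*} [NormedAddCommGroup E] [InnerProductSpace ℂ E]

/-- A nonzero `x` in `W` killed by `R₀` would satisfy `‖x‖ = ‖(R - R₀) x‖ < ‖x‖`. -/
theorem injective_codRestrict_of_norm_sub_lt_one {W W₀ : Submodule ℂ E} [FiniteDimensional ℂ W₀]
    {R R₀ : E →L[ℂ] E} (hR : ∀ x ∈ W, R x = x) (hR₀ : ∀ x, R₀ x ∈ W₀) (h : ‖R - R₀‖ < 1) :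
    Function.Injective ((R₀ : E →ₗ[ℂ] E).codRestrict W₀ hR₀ ∘ₗ W.subtype) := by
  rw [← LinearMap.ker_eq_bot, LinearMap.ker_eq_bot']
  intro x hx
  have hx0 : R₀ (x : E) = 0 := congrArg Subtype.val hx
  by_contra hne
  have hpos : 0 < ‖(x : E)‖ := by simpa using hne
  have h1 := (R - R₀).le_opNorm (x : E)
  simp only [sub_apply, hx0, hR x x.2, sub_zero] at h1
  nlinarith

theorem finiteDimensional_of_norm_sub_lt_one {W W₀ : Submodule ℂ E} [FiniteDimensional ℂ W₀]
    {R R₀ : E →L[ℂ] E} (hR : ∀ x ∈ W, R x = x) (hR₀ : ∀ x, R₀ x ∈ W₀) (h : ‖R - R₀‖ < 1) :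
    FiniteDimensional ℂ W :=
  .of_injective _ (injective_codRestrict_of_norm_sub_lt_one hR hR₀ h)

/-- Two projections of finite rank at distance less than one that commute with `U` give the same
trace of `U`. -/
theorem trace_restrict_eq_of_norm_sub_lt_one {W W₀ : Submodule ℂ E} [FiniteDimensional ℂ W]
    [FiniteDimensional ℂ W₀] {R R₀ : E →L[ℂ] E} (hR : ∀ x ∈ W, R x = x) (hR' : ∀ x, R x ∈ W)
    (hR₀ : ∀ x ∈ W₀, R₀ x = x) (hR₀' : ∀ x, R₀ x ∈ W₀) (h : ‖R - R₀‖ < 1)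
    (U : E →ₗ[ℂ] E) (hU : ∀ x ∈ W, U x ∈ W) (hU₀ : ∀ x ∈ W₀, U x ∈ W₀)
    (hc : ∀ x, R₀ (U x) = U (R₀ x)) :
    LinearMap.trace ℂ W (U.restrict hU) = LinearMap.trace ℂ W₀ (U.restrict hU₀) := by
  have i1 := injective_codRestrict_of_norm_sub_lt_one hR hR₀' h
  have i2 := injective_codRestrict_of_norm_sub_lt_one hR₀ hR' (by rwa [norm_sub_rev])
  have hd : Module.finrank ℂ W = Module.finrank ℂ W₀ :=
    le_antisymm (LinearMap.finrank_le_finrank_of_injective i1)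
      (LinearMap.finrank_le_finrank_of_injective i2)
  -- `R₀` restricts to an isomorphism of `W` onto `W₀` that intertwines `U`.
  let e : W ≃ₗ[ℂ] W₀ := LinearEquiv.ofBijective _
    ⟨i1, (LinearMap.injective_iff_surjective_of_finrank_eq_finrank hd).1 i1⟩
  rw [← LinearMap.trace_conj' _ e]
  congr 1
  ext x
  obtain ⟨y, rfl⟩ := e.surjective x
  simp [LinearEquiv.conj_apply, e, hc]

end Projection

/-! ### Functional calculus on spectral subspaces -/

section Spectral

variable {E : Type*} [NormedAddCommGroup E] [InnerProductSpace ℂ E] [CompleteSpace E]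
variable {T U : E →L[ℂ] E}

theorem spectralSubspace_mono (T : E →L[ℂ] E) {K L : Set ℝ} (h : K ⊆ L) :
    spectralSubspace T K ≤ spectralSubspace T L := fun _ hx =>
  mem_spectralSubspace.2 fun f hf => mem_spectralSubspace.1 hx f (hf.mono h)

theorem commute_star_of_isSelfAdjoint (hT : IsSelfAdjoint T) (hU : Commute T U) :
    Commute T (star U) := by
  simpa [hT.star_eq] using hU.star_star

/-- An operator commuting with a self-adjoint `T` preserves the orthogonal complements of the
spectral subspaces of `T`. -/
theorem mapsTo_orthogonal_spectralSubspace (hT : IsSelfAdjoint T) (hU : Commute T U) (K : Set ℝ) :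
    ∀ x ∈ (spectralSubspace T K)ᗮ, U x ∈ (spectralSubspace T K)ᗮ := by
  intro x hx
  rw [Submodule.mem_orthogonal] at hx ⊢
  intro u hu
  rw [← ContinuousLinearMap.adjoint_inner_left]
  exact hx _ (mapsTo_spectralSubspace (commute_star_of_isSelfAdjoint hT hU) K u hu)

theorem commute_spectralProj (hT : IsSelfAdjoint T) (hU : Commute T U) (K : Set ℝ) :
    Commute (spectralProj T K) U := by
  ext x
  refine Submodule.eq_starProjection_of_mem_orthogonal (K := spectralSubspace T K) ?_ ?_
  · exact mapsTo_spectralSubspace hU K _ (Submodule.starProjection_apply_mem _ _)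
  · change U x - U _ ∈ _
    rw [← map_sub]
    exact mapsTo_orthogonal_spectralSubspace hT hU K _
      (Submodule.sub_starProjection_mem_orthogonal _)

theorem commute_cfc (f : ℝ → ℝ) : Commute T (cfc f T : E →L[ℂ] E) :=
  (Commute.refl T).cfc_real f |>.symm

theorem cfc_apply_cfc_apply (f g : C(ℝ, ℝ)) (x : E) :
    (cfc (f : ℝ → ℝ) T : E →L[ℂ] E) ((cfc (g : ℝ → ℝ) T : E →L[ℂ] E) x) =
      (cfc ((f * g : C(ℝ, ℝ)) : ℝ → ℝ) T : E →L[ℂ] E) x := by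
  have := cfc_mul (f : ℝ → ℝ) (g : ℝ → ℝ) T
  exact (congrArg (fun S : E →L[ℂ] E => S x) this).symm

theorem cfc_one_sub_apply (hT : IsSelfAdjoint T) (f : C(ℝ, ℝ)) (x : E) :
    (cfc ((1 - f : C(ℝ, ℝ)) : ℝ → ℝ) T : E →L[ℂ] E) x =
      x - (cfc (f : ℝ → ℝ) T : E →L[ℂ] E) x := by
  have := cfc_sub (fun _ => (1 : ℝ)) (f : ℝ → ℝ) T
  rw [cfc_const_one ℝ T] at this
  exact congrArg (fun S : E →L[ℂ] E => S x) this

/-- The range of `f(T)` on the subspace of `K` lies in the subspace of `L` if `f` vanishes on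
`K \ L`. -/
theorem cfc_mem_spectralSubspace {K L : Set ℝ} (f : C(ℝ, ℝ)) (hf : ∀ r ∈ K, r ∉ L → f r = 0)
    {x : E} (hx : x ∈ spectralSubspace T K) :
    (cfc (f : ℝ → ℝ) T : E →L[ℂ] E) x ∈ spectralSubspace T L := by
  rw [mem_spectralSubspace] at hx ⊢
  intro k hk
  rw [cfc_apply_cfc_apply]
  refine hx _ fun r hr => ?_
  by_cases h : r ∈ L
  · simp [hk h]
  · simp [hf r hr h]

theorem cfc_apply_eq_self (hT : IsSelfAdjoint T) {K : Set ℝ} (f : C(ℝ, ℝ)) (hf : Set.EqOn f 1 K)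
    {x : E} (hx : x ∈ spectralSubspace T K) : (cfc (f : ℝ → ℝ) T : E →L[ℂ] E) x = x := by
  have := mem_spectralSubspace.1 hx (1 - f) fun r hr => by simp [hf hr]
  rw [cfc_one_sub_apply hT, sub_eq_zero] at this
  exact this.symm

/-- A continuous function that agrees on the spectrum with the indicator function of `K` computes
the spectral projection. -/
theorem spectralProj_eq_cfc (hT : IsSelfAdjoint T) {K : Set ℝ} (f : C(ℝ, ℝ))
    (hf : Set.EqOn f 1 K) (hf' : ∀ r ∈ spectrum ℝ T, r ∉ K → f r = 0) :
    spectralProj T K = cfc (f : ℝ → ℝ) T := by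
  have hmem : ∀ x, (cfc (f : ℝ → ℝ) T : E →L[ℂ] E) x ∈ spectralSubspace T K := by
    intro x
    rw [mem_spectralSubspace]
    intro k hk
    rw [cfc_apply_cfc_apply]
    have : (cfc ((k * f : C(ℝ, ℝ)) : ℝ → ℝ) T : E →L[ℂ] E) = cfc (fun _ => (0 : ℝ)) T := by
      refine cfc_congr fun r hr => ?_
      by_cases h : r ∈ K
      · simp [hk h]
      · simp [hf' r hr h]
    rw [this, cfc_const_zero]
    rfl
  ext x
  refine Submodule.eq_starProjection_of_mem_orthogonal (K := spectralSubspace T K) (hmem x) ?_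
  rw [Submodule.mem_orthogonal]
  intro u hu
  have hsa : IsSelfAdjoint (cfc (f : ℝ → ℝ) T : E →L[ℂ] E) := cfc_predicate _ _
  -- `f(T)` is self-adjoint and fixes `u`, so `⟪u, f(T) x⟫ = ⟪u, x⟫`.
  rw [inner_sub_right, ← ContinuousLinearMap.adjoint_inner_left,
    ← ContinuousLinearMap.star_eq_adjoint, hsa.star_eq, cfc_apply_eq_self hT f hf hu, sub_self]

end Spectral

section Ramp

/-- The piecewise linear function that is `0` on `(-∞, p]` and `1` on `[q, ∞)`, for `p < q`. -/
def ramp (p q : ℝ) : C(ℝ, ℝ) :=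
  ⟨fun x => max 0 (min 1 ((x - p) / (q - p))), by fun_prop⟩

theorem ramp_of_le {p q x : ℝ} (hpq : p < q) (hx : x ≤ p) : ramp p q x = 0 := by
  have : (x - p) / (q - p) ≤ 0 := div_nonpos_of_nonpos_of_nonneg (by linarith) (by linarith)
  exact max_eq_left (min_le_of_right_le this)

theorem ramp_of_ge {p q x : ℝ} (hpq : p < q) (hx : q ≤ x) : ramp p q x = 1 := by
  have : 1 ≤ (x - p) / (q - p) := (one_le_div (by linarith)).2 (by linarith)
  change max 0 (min 1 _) = 1
  rw [min_eq_left this, max_eq_right zero_le_one]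

end Ramp

/-! ### Cutting spectral intervals at one parameter -/

section Column

variable {E : Type*} [NormedAddCommGroup E] [InnerProductSpace ℂ E] [CompleteSpace E]
variable {T U : E →L[ℂ] E}

/-- Cutting a segment at a point outside the spectrum splits the trace. -/
theorem spectralTrace_add (hT : IsSelfAdjoint T) (hU : Commute T U) {p y q : ℝ} (hpy : p ≤ y)
    (hyq : y ≤ q) (hy : y ∉ spectrum ℝ T)
    [FiniteDimensional ℂ (spectralSubspace T (Set.Icc p q))] :
    spectralTrace T U hU (Set.Icc p y) + spectralTrace T U hU (Set.Icc y q) =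
      spectralTrace T U hU (Set.Icc p q) := by
  obtain ⟨ε, hε, hball⟩ := Metric.isOpen_iff.1 (spectrum.isClosed (𝕜 := ℝ) T).isOpen_compl y hy
  have hgap : ∀ r ∈ spectrum ℝ T, r ≤ y - ε ∨ y + ε ≤ r := by
    intro r hr
    by_contra! h
    refine hball (?_ : r ∈ Metric.ball y ε) hr
    rw [Metric.mem_ball, Real.dist_eq, abs_lt]
    constructor <;> linarith [h.1, h.2]
  -- Two functions with the same values on the spectrum, separating it above and below `y`.
  let f := 1 - ramp y (y + ε)
  let g := 1 - ramp (y - ε) y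
  have hfg : (cfc (f : ℝ → ℝ) T : E →L[ℂ] E) = cfc (g : ℝ → ℝ) T := by
    refine cfc_congr fun r hr => ?_
    rcases hgap r hr with h | h
    · simp [f, g, ramp_of_le (show y < y + ε by linarith) (show r ≤ y by linarith),
        ramp_of_le (show y - ε < y by linarith) h]
    · simp [f, g, ramp_of_ge (show y < y + ε by linarith) h,
        ramp_of_ge (show y - ε < y by linarith) (show y ≤ r by linarith)]
  symm
  -- Use whichever function has the right value at `y`: `f` is still `1` there, `g` already `0`.
  refine trace_restrict_eq_add (spectralSubspace_mono T (Set.Icc_subset_Icc_right hyq))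
    (spectralSubspace_mono T (Set.Icc_subset_Icc_left hpy)) (U : E →ₗ[ℂ] E)
    ((cfc (f : ℝ → ℝ) T : E →L[ℂ] E) : E →ₗ[ℂ] E) _ _ _ ?_ ?_ ?_ ?_
  · intro x hx
    change (cfc (f : ℝ → ℝ) T : E →L[ℂ] E) x ∈ _
    rw [hfg]
    refine cfc_mem_spectralSubspace g (fun r hr hr' => ?_) hx
    have : y ≤ r := by
      by_contra! h
      exact hr' ⟨hr.1, h.le⟩
    simp [g, ramp_of_ge (show y - ε < y by linarith) this]
  · intro x hx
    refine cfc_apply_eq_self hT f (fun r hr => ?_) hx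
    simp [f, ramp_of_le (show y < y + ε by linarith) hr.2]
  · intro x hx
    change x - (cfc (f : ℝ → ℝ) T : E →L[ℂ] E) x ∈ _
    rw [← cfc_one_sub_apply hT]
    refine cfc_mem_spectralSubspace (1 - f) (fun r hr hr' => ?_) hx
    have : r ≤ y := by
      by_contra! h
      exact hr' ⟨h.le, hr.2⟩
    simp [f, ramp_of_le (show y < y + ε by linarith) this]
  · intro x hx
    change (cfc (f : ℝ → ℝ) T : E →L[ℂ] E) x = 0
    rw [hfg]
    refine mem_spectralSubspace.1 hx g fun r hr => ?_
    simp [g, ramp_of_ge (show y - ε < y by linarith) hr.1]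

/-- A function vanishing at `0` splits into its parts on the two half-lines. If it vanishes on `[0,
a]`, the negative part vanishes on `[0, b]` and the positive part on `[-a, a]`. -/
theorem mem_spectralSubspace_Icc_zero {a b : ℝ} (ha : 0 ≤ a) {x : E}
    (hx : x ∈ spectralSubspace T (Set.Icc 0 b)) (hx' : x ∈ spectralSubspace T (Set.Icc (-a) a)) :
    x ∈ spectralSubspace T (Set.Icc 0 a) := by
  rw [mem_spectralSubspace] at *
  intro f hf
  have hf0 : f 0 = 0 := hf ⟨le_rfl, ha⟩
  let f₁ : C(ℝ, ℝ) := ⟨fun r => f (min r 0), by fun_prop⟩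
  let f₂ : C(ℝ, ℝ) := ⟨fun r => f (max r 0), by fun_prop⟩
  have hadd : (cfc (f : ℝ → ℝ) T : E →L[ℂ] E) =
      cfc (f₁ : ℝ → ℝ) T + cfc (f₂ : ℝ → ℝ) T := by
    rw [← cfc_add T (f₁ : ℝ → ℝ) (f₂ : ℝ → ℝ)]
    refine cfc_congr fun r _ => ?_
    rcases le_total r 0 with h | h <;> simp [f₁, f₂, h, hf0]
  rw [hadd, add_apply, hx f₁ fun r hr => ?_, hx' f₂ fun r hr => ?_, add_zero]
  · exact hf ⟨le_max_right _ _, max_le hr.2 ha⟩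
  · simp [f₁, hr.1, hf0]

/-- The spectral subspace belonging to `(a, b]`. -/
def upperSubspace (T : E →L[ℂ] E) (a b : ℝ) : Submodule ℂ E :=
  spectralSubspace T (Set.Icc 0 b) ⊓ (spectralSubspace T (Set.Icc (-a) a))ᗮ

theorem mapsTo_upperSubspace (hT : IsSelfAdjoint T) (hU : Commute T U) (a b : ℝ) :
    ∀ x ∈ upperSubspace T a b, (U : E →ₗ[ℂ] E) x ∈ upperSubspace T a b := fun x hx =>
  ⟨mapsTo_spectralSubspace hU _ x hx.1, mapsTo_orthogonal_spectralSubspace hT hU _ x hx.2⟩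

/-- Splitting by the projection of `[-a, a]` instead of a continuous function allows `a` to lie in
the spectrum, as may happen inside a column. -/
theorem spectralTrace_eq_add_upperSubspace (hT : IsSelfAdjoint T) (hU : Commute T U) {a b : ℝ}
    (ha : 0 ≤ a) (hab : a ≤ b) [FiniteDimensional ℂ (spectralSubspace T (Set.Icc 0 b))] :
    spectralTrace T U hU (Set.Icc 0 b) = spectralTrace T U hU (Set.Icc 0 a) +
      LinearMap.trace ℂ (upperSubspace T a b)
        ((U : E →ₗ[ℂ] E).restrict (mapsTo_upperSubspace hT hU a b)) := by
  have hP : ∀ x ∈ spectralSubspace T (Set.Icc 0 b),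
      spectralProj T (Set.Icc (-a) a) x ∈ spectralSubspace T (Set.Icc 0 b) :=
    mapsTo_spectralSubspace (commute_spectralProj hT (.refl T) _).symm _
  refine trace_restrict_eq_add (spectralSubspace_mono T (Set.Icc_subset_Icc_right hab))
    inf_le_left (U : E →ₗ[ℂ] E) (spectralProj T (Set.Icc (-a) a) : E →ₗ[ℂ] E) _ _ _ ?_ ?_ ?_ ?_
  · exact fun x hx => mem_spectralSubspace_Icc_zero ha (hP x hx)
      (Submodule.starProjection_apply_mem _ _)
  · exact fun x hx => Submodule.starProjection_eq_self_iff.2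
      (spectralSubspace_mono T (Set.Icc_subset_Icc_left (by linarith)) hx)
  · exact fun x hx => ⟨Submodule.sub_mem _ hx (hP x hx),
      Submodule.sub_starProjection_mem_orthogonal _⟩
  · exact fun x hx => (Submodule.starProjection_apply_eq_zero_iff _).2 hx.2

/-- A projection onto `upperSubspace T a b` that depends continuously on `T` as soon as the
spectral projections of `[-a, a]` and `[-b, b]` do. -/
def upperProj (T : E →L[ℂ] E) (a b : ℝ) : E →L[ℂ] E :=
  cfc (ramp 0 a : ℝ → ℝ) T *
    (spectralProj T (Set.Icc (-b) b) - spectralProj T (Set.Icc (-a) a))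

theorem upperProj_apply (T : E →L[ℂ] E) (a b : ℝ) (x : E) :
    upperProj T a b x = (cfc (ramp 0 a : ℝ → ℝ) T : E →L[ℂ] E)
      (spectralProj T (Set.Icc (-b) b) x - spectralProj T (Set.Icc (-a) a) x) := rfl

theorem commute_upperProj (hT : IsSelfAdjoint T) (hU : Commute T U) (a b : ℝ) :
    Commute (upperProj T a b) U :=
  (hU.cfc_real _).mul_left
    ((commute_spectralProj hT hU _).sub_left (commute_spectralProj hT hU _))

/-- The difference of the projections lands in the subspace of `[-b, b]`, orthogonally to that of
`[-a, a]`. The ramp preserves this orthogonality and removes the negative part. -/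
theorem upperProj_mem (hT : IsSelfAdjoint T) {a b : ℝ} (ha : 0 < a) (hab : a ≤ b) (x : E) :
    upperProj T a b x ∈ upperSubspace T a b := by
  rw [upperProj_apply]
  constructor
  · refine cfc_mem_spectralSubspace (K := Set.Icc (-b) b) _ (fun r hr hr' => ?_) ?_
    · refine ramp_of_le ha ?_
      by_contra! h
      exact hr' ⟨h.le, hr.2⟩
    · exact Submodule.sub_mem _ (Submodule.starProjection_apply_mem _ _)
        (spectralSubspace_mono T (Set.Icc_subset_Icc (by linarith) hab)
          (Submodule.starProjection_apply_mem _ _))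
  · refine mapsTo_orthogonal_spectralSubspace hT (commute_cfc _) _ _ ?_
    have h1 : spectralProj T (Set.Icc (-b) b) x - spectralProj T (Set.Icc (-a) a) x =
        (x - spectralProj T (Set.Icc (-a) a) x) - (x - spectralProj T (Set.Icc (-b) b) x) := by
      abel
    rw [h1]
    exact Submodule.sub_mem _ (Submodule.sub_starProjection_mem_orthogonal _)
      (Submodule.orthogonal_le (spectralSubspace_mono T (Set.Icc_subset_Icc (by linarith) hab))
        (Submodule.sub_starProjection_mem_orthogonal _))

theorem upperProj_apply_eq_self (hT : IsSelfAdjoint T) {a b : ℝ} (ha : 0 < a) (hab : a ≤ b) {x : E}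
    (hx : x ∈ upperSubspace T a b) : upperProj T a b x = x := by
  have h1 : spectralProj T (Set.Icc (-b) b) x = x := Submodule.starProjection_eq_self_iff.2
    (spectralSubspace_mono T (Set.Icc_subset_Icc_left (by linarith)) hx.1)
  have h2 : spectralProj T (Set.Icc (-a) a) x = 0 :=
    (Submodule.starProjection_apply_eq_zero_iff _).2 hx.2
  rw [upperProj_apply, h1, h2, sub_zero]
  -- The defect `x - ramp(T) x` lies both in the subspace of `[-a, a]` and in its orthogonal
  -- complement, hence is zero.
  have h3 : x - (cfc (ramp 0 a : ℝ → ℝ) T : E →L[ℂ] E) x ∈ spectralSubspace T (Set.Icc (-a) a) := by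
    rw [← cfc_one_sub_apply hT]
    refine cfc_mem_spectralSubspace _ (fun r hr hr' => ?_) hx.1
    have : a ≤ r := by
      by_contra! h
      exact hr' ⟨by linarith [hr.1], h.le⟩
    simp [ramp_of_ge ha this]
  have h4 : x - (cfc (ramp 0 a : ℝ → ℝ) T : E →L[ℂ] E) x ∈
      (spectralSubspace T (Set.Icc (-a) a))ᗮ :=
    Submodule.sub_mem _ hx.2 (mapsTo_orthogonal_spectralSubspace hT (commute_cfc _) _ _ hx.2)
  have h5 := Submodule.disjoint_def.1 (Submodule.orthogonal_disjoint _) _ h3 h4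
  exact (sub_eq_zero.1 h5).symm

end Column

/-! ### Constancy of trace differences along a path -/

section Path

variable {E : Type*} [NormedAddCommGroup E] [InnerProductSpace ℂ E] [CompleteSpace E]

theorem continuousOn_upperProj {X : Type*} [TopologicalSpace X] {S : Set X} {T : X → E →L[ℂ] E}
    (hT : ∀ t, IsSelfAdjoint (T t)) (hcont : Continuous T) {a b : ℝ}
    (hca : ContinuousOn (fun t => spectralProj (T t) (Set.Icc (-a) a)) S)
    (hcb : ContinuousOn (fun t => spectralProj (T t) (Set.Icc (-b) b)) S) :
    ContinuousOn (fun t => upperProj (T t) a b) S := by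
  refine ContinuousOn.mul ?_ (hcb.sub hca)
  exact (hcont.cfc_of_mem_nhdsSet (s := Set.univ) (ramp 0 a : ℝ → ℝ) (by simp) hT).continuousOn

/-- Over a connected set of parameters on which the spectral projections of `[-a, a]` and `[-b, b]`
are continuous of finite rank, the traces on the subspaces of `[0, a]` and `[0, b]` differ by a
constant. -/
theorem spectralTrace_sub_eq {X : Type*} [TopologicalSpace X] {S : Set X} (hS : IsPreconnected S)
    {T : X → E →L[ℂ] E} {U : E →L[ℂ] E} (hT : ∀ t, IsSelfAdjoint (T t)) (hcont : Continuous T)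
    (hU : ∀ t, Commute (T t) U) {a b : ℝ} (ha : 0 < a) (hab : a ≤ b)
    (hca : ContinuousOn (fun t => spectralProj (T t) (Set.Icc (-a) a)) S)
    (hcb : ContinuousOn (fun t => spectralProj (T t) (Set.Icc (-b) b)) S)
    (hfd : ∀ t ∈ S, FiniteDimensional ℂ (spectralSubspace (T t) (Set.Icc (-b) b)))
    {s t : X} (hs : s ∈ S) (ht : t ∈ S) :
    spectralTrace (T s) U (hU s) (Set.Icc 0 b) - spectralTrace (T s) U (hU s) (Set.Icc 0 a) =
      spectralTrace (T t) U (hU t) (Set.Icc 0 b) - spectralTrace (T t) U (hU t) (Set.Icc 0 a) := by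
  have hfd' : ∀ t ∈ S, FiniteDimensional ℂ (spectralSubspace (T t) (Set.Icc 0 b)) := fun t ht => by
    have := hfd t ht
    exact Submodule.finiteDimensional_of_le
      (spectralSubspace_mono (T t) (Set.Icc_subset_Icc_left (by linarith : -b ≤ 0)))
  have hfd'' : ∀ t ∈ S, FiniteDimensional ℂ (upperSubspace (T t) a b) := fun t ht => by
    have := hfd' t ht
    exact Submodule.finiteDimensional_of_le inf_le_left
  -- On a preconnected set it suffices to compare each point with nearby ones.
  refine hS.induction₂ (fun s t =>
    spectralTrace (T s) U (hU s) (Set.Icc 0 b) - spectralTrace (T s) U (hU s) (Set.Icc 0 a) =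
      spectralTrace (T t) U (hU t) (Set.Icc 0 b) - spectralTrace (T t) U (hU t) (Set.Icc 0 a))
    (fun s hs => ?_) (fun _ _ _ _ _ _ => Eq.trans) (fun _ _ _ _ => Eq.symm) hs ht
  have hnear : ∀ᶠ t in nhdsWithin s S, ‖upperProj (T t) a b - upperProj (T s) a b‖ < 1 := by
    have := (continuousOn_upperProj hT hcont hca hcb s hs).sub
      (continuousWithinAt_const (b := upperProj (T s) a b))
    refine this.norm.eventually_lt continuousWithinAt_const ?_
    simp
  filter_upwards [hnear, self_mem_nhdsWithin] with t hst ht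
  have := hfd' s hs
  have := hfd' t ht
  have := hfd'' s hs
  have := hfd'' t ht
  rw [spectralTrace_eq_add_upperSubspace (hT s) (hU s) ha.le hab,
    spectralTrace_eq_add_upperSubspace (hT t) (hU t) ha.le hab, add_sub_cancel_left,
    add_sub_cancel_left]
  symm
  exact trace_restrict_eq_of_norm_sub_lt_one
    (fun x hx => upperProj_apply_eq_self (hT t) ha hab hx) (upperProj_mem (hT t) ha hab)
    (fun x hx => upperProj_apply_eq_self (hT s) ha hab hx) (upperProj_mem (hT s) ha hab) hst _ _ _
    fun x => congrArg (fun S : E →L[ℂ] E => S x) (commute_upperProj (hT s) (hU s) a b).eq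

end Path

/-! ### Combinatorics of partitions -/

section Telescoping

/-- Vertical telescoping for a quantity that is additive at the interior partition points. -/
theorem sum_cells_eq (τ : ℝ → ℝ → ℂ) {m : ℕ} (hm : 0 < m) (y : Fin (m + 1) → ℝ) (hy : y 0 = 0)
    (hτ : ∀ i : Fin m, i.castSucc ≠ 0 →
      τ 0 (y i.castSucc) + τ (y i.castSucc) (y i.succ) = τ 0 (y i.succ)) :
    ∑ i : Fin m, τ (y i.castSucc) (y i.succ) = τ 0 (y (Fin.last m)) := by
  induction m, hm using Nat.le_induction with
  -- The first cell starts at `0`, so additivity is never needed there, where the spectrum may sit.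
  | base => simp [hy]
  | succ m hm ih =>
    rw [Fin.sum_univ_castSucc]
    have := ih (fun i => y i.castSucc) (by simpa using hy) fun i hi => by
      have := hτ i.castSucc (by simpa [Fin.ext_iff] using hi)
      simpa only [Fin.succ_castSucc] using this
    simp only [Fin.succ_castSucc] at this ⊢
    rw [this]
    exact hτ (Fin.last m) (by simp [Fin.ext_iff]; lia)

theorem sum_min_sub_min {n : ℕ} (t : Fin (n + 1) → I) (g : I → ℂ) (x : I) :
    ∑ k : Fin n, (g (min x (t k.succ)) - g (min x (t k.castSucc))) =
      g (min x (t (Fin.last n))) - g (min x (t 0)) := by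
  induction n with
  | zero => simp
  | succ n ih =>
    rw [Fin.sum_univ_castSucc]
    have := ih (fun k => t k.castSucc)
    simp only [Fin.succ_castSucc] at this ⊢
    rw [this]
    simp

/-- For `p ≤ q` and monotone `t`, the `k`-th summand is the increment of `g` over the part of `[p,
q]` inside the `k`-th subinterval. Truncation by `min` thus replaces a common refinement. -/
theorem sub_eq_sum_min {n : ℕ} (t : Fin (n + 1) → I) (h0 : t 0 = 0) (h1 : t (Fin.last n) = 1)
    (g : I → ℂ) (p q : I) :
    g q - g p = ∑ k : Fin n, ((g (min q (t k.succ)) - g (min q (t k.castSucc))) -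
      (g (min p (t k.succ)) - g (min p (t k.castSucc)))) := by
  have hx : ∀ x : I, min x (t (Fin.last n)) = x := fun x => by
    rw [h1]; exact min_eq_left x.2.2
  have hx' : ∀ x : I, min x (t 0) = 0 := fun x => by
    rw [h0]; exact min_eq_right x.2.1
  rw [Finset.sum_sub_distrib, sum_min_sub_min, sum_min_sub_min, hx, hx, hx', hx']
  ring

/-- The expression is the increment of `D` from `max p r` to `min q s` when the intervals overlap,
and cancels identically otherwise. -/
theorem second_difference_min_eq_zero (D : I → ℂ) {p q r s : I} (hpq : p ≤ q) (hrs : r ≤ s)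
    (hD : ∀ x ∈ Set.Icc p q ∩ Set.Icc r s, ∀ y ∈ Set.Icc p q ∩ Set.Icc r s, D x = D y) :
    (D (min q s) - D (min q r)) - (D (min p s) - D (min p r)) = 0 := by
  rcases le_total q r with h | h
  · rw [min_eq_left h, min_eq_left (h.trans hrs), min_eq_left (hpq.trans h),
      min_eq_left (hpq.trans (h.trans hrs))]
    ring
  rcases le_total s p with h' | h'
  · rw [min_eq_right h', min_eq_right (h'.trans hpq), min_eq_right h,
      min_eq_right (hrs.trans h')]
    ring
  rw [min_eq_right h, min_eq_left h']
  have key : D (min q s) = D (max p r) := by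
    refine hD _ ⟨⟨le_min hpq h', min_le_left _ _⟩, ⟨le_min h hrs, min_le_right _ _⟩⟩ _
      ⟨⟨le_max_left _ _, max_le hpq h⟩, ⟨le_max_right _ _, max_le h' hrs⟩⟩
  rw [key]
  rcases le_total p r with h'' | h''
  · rw [max_eq_right h'', min_eq_left h'']; ring
  · rw [max_eq_left h'', min_eq_right h'']; ring

/-- Two sums of increments over partitions of the unit interval agree if the functions involved
differ by constants on the common subintervals. -/
theorem sum_increments_eq {n n' : ℕ} {t : Fin (n + 1) → I} {t' : Fin (n' + 1) → I}
    (ht : Monotone t) (ht' : Monotone t') (h0 : t 0 = 0) (h1 : t (Fin.last n) = 1)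
    (h0' : t' 0 = 0) (h1' : t' (Fin.last n') = 1) (g : Fin n → I → ℂ) (g' : Fin n' → I → ℂ)
    (hg : ∀ j k, ∀ x ∈ Set.Icc (t j.castSucc) (t j.succ) ∩ Set.Icc (t' k.castSucc) (t' k.succ),
      ∀ y ∈ Set.Icc (t j.castSucc) (t j.succ) ∩ Set.Icc (t' k.castSucc) (t' k.succ),
        g j x - g' k x = g j y - g' k y) :
    ∑ j, (g j (t j.succ) - g j (t j.castSucc)) =
      ∑ k, (g' k (t' k.succ) - g' k (t' k.castSucc)) := by
  -- Each increment is split along the other partition; both sides become double sums over overlaps,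
  -- compared termwise.
  calc _ = ∑ j, ∑ k : Fin n', _ :=
        Finset.sum_congr rfl fun j _ => sub_eq_sum_min t' h0' h1' (g j) _ _
    _ = ∑ k, ∑ j : Fin n, _ := Finset.sum_comm
    _ = _ := Finset.sum_congr rfl fun k _ => by
      rw [sub_eq_sum_min t h0 h1 (g' k) (t' k.castSucc) (t' k.succ)]
      refine Finset.sum_congr rfl fun j _ => ?_
      have := second_difference_min_eq_zero (fun x => g j x - g' k x)
        (ht (Fin.castSucc_lt_succ (i := j)).le) (ht' (Fin.castSucc_lt_succ (i := k)).le) (hg j k)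
      rw [min_comm (t' k.succ) (t j.succ), min_comm (t' k.succ) (t j.castSucc),
        min_comm (t' k.castSucc) (t j.succ), min_comm (t' k.castSucc) (t j.castSucc)]
      linear_combination this

end Telescoping

/-! ### Comparison of good grids -/

namespace Grid

variable {H : Type*} [Group H] [TopologicalSpace H] [IsTopologicalGroup H] [CompactSpace H]
  [MeasurableSpace H] [BorelSpace H]
variable {V : Type*} [NormedAddCommGroup V] [InnerProductSpace ℂ V] [CompleteSpace V]

theorem height_pos (G : Grid) (j : Fin G.n) : 0 < G.height j := by
  rw [← G.y_zero j]
  refine G.y_strictMono j (?_ : (0 : Fin (G.m j + 1)) < Fin.last (G.m j))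
  exact Fin.lt_def.2 (by simpa using G.m_pos j)

theorem y_nonneg (G : Grid) (j : Fin G.n) (i : Fin (G.m j + 1)) : 0 ≤ G.y j i := by
  rw [← G.y_zero j]
  exact (G.y_strictMono j).monotone (Fin.zero_le i)

theorem y_le_height (G : Grid) (j : Fin G.n) (i : Fin (G.m j + 1)) : G.y j i ≤ G.height j :=
  (G.y_strictMono j).monotone (Fin.le_last i)

theorem t_castSucc_le_succ (G : Grid) (j : Fin G.n) : G.t j.castSucc ≤ G.t j.succ :=
  G.t_strictMono.monotone Fin.castSucc_lt_succ.le

/-- The trace of `h` on the spectral subspace of `B t` belonging to `[0, a]`. -/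
def lowerTrace (h : H) (B : C(I, FredStar H V)) (a : ℝ) (t : I) : ℂ :=
  spectralTrace (B t : HilbL2 H V →L[ℂ] HilbL2 H V) (leftReg V h) ((B t).2.2.2.1 h) (Set.Icc 0 a)

theorem sum_spectralTrace_column (h : H) (B : C(I, FredStar H V)) (G : Grid) (j : Fin G.n) (t : I)
    [FiniteDimensional ℂ (spectralSubspace (B t : HilbL2 H V →L[ℂ] HilbL2 H V)
      (Set.Icc (-G.height j) (G.height j)))]
    (hns : ∀ i : Fin (G.m j + 1), i ≠ 0 →
      G.y j i ∉ spectrum ℝ (B t : HilbL2 H V →L[ℂ] HilbL2 H V)) :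
    ∑ i : Fin (G.m j), spectralTrace (B t : HilbL2 H V →L[ℂ] HilbL2 H V) (leftReg V h)
        ((B t).2.2.2.1 h) (Set.Icc (G.y j i.castSucc) (G.y j i.succ)) =
      lowerTrace h B (G.height j) t := by
  refine sum_cells_eq (fun p q => spectralTrace (B t : HilbL2 H V →L[ℂ] HilbL2 H V) (leftReg V h)
    ((B t).2.2.2.1 h) (Set.Icc p q)) (G.m_pos j) (G.y j) (G.y_zero j) fun i hi => ?_
  have : FiniteDimensional ℂ (spectralSubspace (B t : HilbL2 H V →L[ℂ] HilbL2 H V)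
      (Set.Icc 0 (G.y j i.succ))) :=
    Submodule.finiteDimensional_of_le (spectralSubspace_mono _
      (Set.Icc_subset_Icc (neg_nonpos.2 (G.height_pos j).le) (G.y_le_height j i.succ)))
  exact spectralTrace_add (B t).2.1 _ (G.y_nonneg j _)
    (G.y_strictMono j Fin.castSucc_lt_succ).le (hns _ hi)

theorem traceSum_eq_sum_lowerTrace (h : H) {B : C(I, FredStar H V)} {G : Grid} (hG : G.IsGood B) :
    G.traceSum h B = ∑ j : Fin G.n, (lowerTrace h B (G.height j) (G.t j.succ) -
      lowerTrace h B (G.height j) (G.t j.castSucc)) := by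
  refine Finset.sum_congr rfl fun j _ => ?_
  have := (hG.2 j).1 _ (Set.left_mem_Icc.2 (G.t_castSucc_le_succ j))
  have := (hG.2 j).1 _ (Set.right_mem_Icc.2 (G.t_castSucc_le_succ j))
  rw [Finset.sum_sub_distrib,
    sum_spectralTrace_column h B G j _ fun i hi => (hG.1 j i hi).2,
    sum_spectralTrace_column h B G j _ fun i hi => (hG.1 j i hi).1]

theorem lowerTrace_sub_eq (h : H) (B : C(I, FredStar H V)) {S : Set I} (hS : IsPreconnected S)
    {a b : ℝ} (ha : 0 < a) (hb : 0 < b)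
    (hca : ContinuousOn (fun t => spectralProj (B t : HilbL2 H V →L[ℂ] HilbL2 H V)
      (Set.Icc (-a) a)) S)
    (hcb : ContinuousOn (fun t => spectralProj (B t : HilbL2 H V →L[ℂ] HilbL2 H V)
      (Set.Icc (-b) b)) S)
    (hfa : ∀ t ∈ S, FiniteDimensional ℂ (spectralSubspace (B t : HilbL2 H V →L[ℂ] HilbL2 H V)
      (Set.Icc (-a) a)))
    (hfb : ∀ t ∈ S, FiniteDimensional ℂ (spectralSubspace (B t : HilbL2 H V →L[ℂ] HilbL2 H V)
      (Set.Icc (-b) b)))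
    {s t : I} (hs : s ∈ S) (ht : t ∈ S) :
    lowerTrace h B a s - lowerTrace h B b s = lowerTrace h B a t - lowerTrace h B b t := by
  have hB : Continuous fun t => (B t : HilbL2 H V →L[ℂ] HilbL2 H V) :=
    continuous_subtype_val.comp B.continuous
  rcases le_total a b with hab | hab
  · have := spectralTrace_sub_eq hS (fun t => (B t).2.1) hB (fun t => (B t).2.2.2.1 h) ha hab
      hca hcb hfb hs ht
    unfold lowerTrace
    linear_combination -this
  · exact spectralTrace_sub_eq hS (fun t => (B t).2.1) hB (fun t => (B t).2.2.2.1 h) hb hab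
      hcb hca hfa hs ht

theorem traceSum_eq_of_isGood (h : H) {B : C(I, FredStar H V)} {G G' : Grid} (hG : G.IsGood B)
    (hG' : G'.IsGood B) : G.traceSum h B = G'.traceSum h B := by
  rw [traceSum_eq_sum_lowerTrace h hG, traceSum_eq_sum_lowerTrace h hG']
  refine sum_increments_eq G.t_strictMono.monotone G'.t_strictMono.monotone G.t_zero G.t_last
    G'.t_zero G'.t_last (fun j => lowerTrace h B (G.height j))
    (fun k => lowerTrace h B (G'.height k)) fun j k x hx y hy => ?_
  exact lowerTrace_sub_eq h B
    (Set.ordConnected_Icc.inter Set.ordConnected_Icc).isPreconnected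
    (G.height_pos j) (G'.height_pos k)
    ((hG.2 j).2.mono Set.inter_subset_left) ((hG'.2 k).2.mono Set.inter_subset_right)
    (fun t ht => (hG.2 j).1 t ht.1) (fun t ht => (hG'.2 k).1 t ht.2) hx hy

/-- A column of a refinement lies inside a column of the original grid. -/
theorem Refines.exists_column {G G' : Grid} (hr : G'.Refines G) (k : Fin G'.n) :
    ∃ j : Fin G.n, G.t j.castSucc ≤ G'.t k.castSucc ∧ G'.t k.succ ≤ G.t j.succ := by
  have hlt : G'.t k.castSucc < G.t (Fin.last G.n) := by
    rw [G.t_last, ← G'.t_last]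
    exact G'.t_strictMono (Fin.castSucc_lt_last k)
  -- The first point of `G` beyond the left end of the column is also a point of `G'`, so it cannot
  -- precede the right end.
  obtain ⟨i, hi, hmin⟩ := (Set.toFinite {i | G'.t k.castSucc < G.t i}).exists_minimal ⟨_, hlt⟩
  obtain ⟨j, rfl⟩ : ∃ j : Fin G.n, j.succ = i := by
    refine Fin.exists_succ_eq.2 fun h0 => ?_
    rw [h0] at hi
    change G'.t k.castSucc < G.t 0 at hi
    rw [G.t_zero] at hi
    exact absurd hi (not_lt.2 (G'.t k.castSucc).2.1)
  refine ⟨j, ?_, ?_⟩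
  · by_contra! h
    exact absurd (hmin h Fin.castSucc_lt_succ.le) (not_le.2 Fin.castSucc_lt_succ)
  · obtain ⟨l, hl⟩ := hr.1 ⟨j.succ, rfl⟩
    change G'.t k.castSucc < G.t j.succ at hi
    rw [← hl] at hi ⊢
    exact G'.t_strictMono.monotone (Fin.castSucc_lt_iff_succ_le.1 (G'.t_strictMono.lt_iff_lt.1 hi))

theorem IsGood.of_refines {B : C(I, FredStar H V)} {G G' : Grid} (hG : G.IsGood B)
    (hr : G'.Refines G) (hns : G'.NonsingularAtVertices B) : G'.IsGood B := by
  refine ⟨hns, fun k => ?_⟩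
  obtain ⟨j, h1, h2⟩ := hr.exists_column k
  rw [(hr.2 k j h1 h2).2]
  exact ⟨fun t ht => (hG.2 j).1 t (Set.Icc_subset_Icc h1 h2 ht),
    (hG.2 j).2.mono (Set.Icc_subset_Icc h1 h2)⟩

end Grid

/-! ### Spectral windows of Fredholm operators -/

section Fredholm

variable {E : Type*} [NormedAddCommGroup E] [InnerProductSpace ℂ E] [CompleteSpace E]
variable {T : E →L[ℂ] E}

/-- For the self-adjoint `S = r - T` the bound makes `S * S` coercive, hence invertible, and so `S`
is invertible. -/
theorem notMem_spectrum_of_bound (hT : IsSelfAdjoint T) {r ε : ℝ} (hε : 0 < ε)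
    (h : ∀ x, ε * ‖x‖ ≤ ‖T x - r • x‖) : r ∉ spectrum ℝ T := by
  rw [spectrum.notMem_iff]
  set S : E →L[ℂ] E := algebraMap ℝ (E →L[ℂ] E) r - T with hS
  have hSsa : IsSelfAdjoint S := (IsSelfAdjoint.algebraMap _ (.all r)).sub hT
  have hSx : ∀ x, S x = -(T x - r • x) := fun x => by
    simp [hS, Algebra.algebraMap_eq_smul_one]
  suffices IsUnit (S * S) from ((Commute.refl S).isUnit_mul_iff.1 this).1
  refine ContinuousLinearMap.isUnit_of_forall_le_norm_inner_map _
    (c := ⟨ε ^ 2, by positivity⟩) (show (0 : ℝ) < ε ^ 2 by positivity) fun x => ?_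
  have h1 : inner ℂ ((S * S) x) x = inner ℂ (S x) (S x) := by
    change inner ℂ (S (S x)) x = _
    rw [← ContinuousLinearMap.adjoint_inner_right, ← ContinuousLinearMap.star_eq_adjoint,
      hSsa.star_eq]
  rw [h1, inner_self_eq_norm_sq_to_K, norm_pow, hSx, norm_neg]
  simp only [Complex.coe_algebraMap, Complex.norm_real, norm_norm]
  calc ‖x‖ ^ 2 * ε ^ 2 = (ε * ‖x‖) ^ 2 := by ring
    _ ≤ _ := by gcongr; exact h x

/-- The open mapping theorem gives preimages of controlled norm, and a vector orthogonal to the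
kernel is the shortest preimage of its image. -/
theorem exists_bound_of_isClosed_range (hT : IsClosed (T.range : Set E)) :
    ∃ c > 0, ∀ x ∈ (T.ker)ᗮ, c * ‖x‖ ≤ ‖T x‖ := by
  have : CompleteSpace T.range := hT.completeSpace_coe
  let T' : E →L[ℂ] T.range := T.codRestrict T.range fun x => ⟨x, rfl⟩
  obtain ⟨C, hC, hT'⟩ := T'.exists_preimage_norm_le (by rintro ⟨_, x, rfl⟩; exact ⟨x, rfl⟩)
  refine ⟨C⁻¹, by positivity, fun x hx => ?_⟩
  obtain ⟨z, hz, hzC⟩ := hT' (T' x)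
  have hker : z - x ∈ T.ker := by
    have : T z = T x := congrArg Subtype.val hz
    simp [LinearMap.mem_ker, this]
  have h0 : inner ℂ x (z - x) = 0 := Submodule.inner_left_of_mem_orthogonal hker hx
  have h1 : ‖z‖ ^ 2 = ‖x‖ ^ 2 + ‖z - x‖ ^ 2 := by
    have := norm_add_sq_eq_norm_sq_add_norm_sq_of_inner_eq_zero x (z - x) h0
    rw [add_sub_cancel] at this
    linarith
  have h2 : ‖x‖ ≤ ‖z‖ := by
    refine le_of_sq_le_sq ?_ (norm_nonneg _)
    nlinarith [sq_nonneg ‖z - x‖]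
  rw [inv_mul_le_iff₀ hC]
  exact h2.trans hzC

/-- `T - r` preserves the kernel of `T` and its complement, with lower bounds `|r|` and `c - |r|`
there; Pythagoras combines them. -/
theorem bound_sub_smul (hT : IsSelfAdjoint T) {c : ℝ} (hc : ∀ x ∈ (T.ker)ᗮ, c * ‖x‖ ≤ ‖T x‖)
    {r δ : ℝ} (hδ : 0 ≤ δ) (h1 : δ ≤ |r|) (h2 : δ ≤ c - |r|) (x : E) :
    δ * ‖x‖ ≤ ‖T x - r • x‖ := by
  have : CompleteSpace T.ker := T.isClosed_ker.completeSpace_coe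
  set u := T.ker.starProjection x with hu
  set v := x - u with hv
  have hxu : x = u + v := by simp [hv]
  have hu' : u ∈ T.ker := Submodule.starProjection_apply_mem _ _
  have hv' : v ∈ (T.ker)ᗮ := Submodule.sub_starProjection_mem_orthogonal _
  have hTu : T u = 0 := hu'
  have hTv : T v ∈ (T.ker)ᗮ := by
    rw [Submodule.mem_orthogonal]
    intro k hk
    have hk' : T k = 0 := hk
    rw [← ContinuousLinearMap.adjoint_inner_left, ← ContinuousLinearMap.star_eq_adjoint,
      hT.star_eq, hk', inner_zero_left]
  have hw : T v - r • v ∈ (T.ker)ᗮ :=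
    Submodule.sub_mem _ hTv (Submodule.smul_of_tower_mem _ r hv')
  have hru : -(r • u) ∈ T.ker := Submodule.neg_mem _ (Submodule.smul_of_tower_mem _ r hu')
  have hsplit : T x - r • x = -(r • u) + (T v - r • v) := by
    rw [hxu, map_add, hTu, smul_add]; abel
  have e1 := norm_add_sq_eq_norm_sq_add_norm_sq_of_inner_eq_zero _ _
    (Submodule.inner_right_of_mem_orthogonal hru hw)
  have e2 := norm_add_sq_eq_norm_sq_add_norm_sq_of_inner_eq_zero _ _
    (Submodule.inner_right_of_mem_orthogonal hu' hv')
  rw [← hsplit, norm_neg, norm_smul, Real.norm_eq_abs] at e1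
  rw [← hxu] at e2
  have b1 : δ * ‖u‖ ≤ |r| * ‖u‖ := by gcongr
  have b2 : δ * ‖v‖ ≤ ‖T v - r • v‖ := by
    have := norm_sub_norm_le (T v) (r • v)
    rw [norm_smul, Real.norm_eq_abs] at this
    nlinarith [hc v hv', norm_nonneg v]
  refine le_of_sq_le_sq ?_ (norm_nonneg _)
  have s1 := mul_self_le_mul_self (by positivity) b1
  have s2 := mul_self_le_mul_self (by positivity) b2
  linear_combination s1 + s2 + δ ^ 2 * e2 - e1

/-- The spectrum of a self-adjoint Fredholm operator and of its small perturbations avoids two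
symmetric intervals, and below these intervals only the kernel is left. -/
theorem exists_spectral_gap (hT : IsSelfAdjoint T) (hF : T.IsFredholm) :
    ∃ a > 0, (∀ r ∈ spectrum ℝ T, |r| < 2 * a → r = 0) ∧
      ∃ ε > 0, ∀ S : E →L[ℂ] E, IsSelfAdjoint S → ‖S - T‖ < ε →
        ∀ r ∈ spectrum ℝ S, |r| < a ∨ 3 / 2 * a < |r| := by
  obtain ⟨c, hc0, hc⟩ := exists_bound_of_isClosed_range hF.isClosed_range
  -- With `a = c / 2`, the range `a ≤ |r| ≤ 3 / 2 * a` gives `T - r` the lower bound `c / 4`; a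
  -- perturbation below `c / 8` leaves at least `c / 8`.
  refine ⟨c / 2, by positivity, fun r hr hrc => ?_, c / 8, by positivity,
    fun S hS hST r hr => ?_⟩
  · by_contra hr0
    refine notMem_spectrum_of_bound hT (ε := min |r| (c - |r|)) ?_ (fun x => ?_) hr
    · exact lt_min (abs_pos.2 hr0) (by linarith)
    · exact bound_sub_smul hT hc (le_min (abs_nonneg r) (by linarith)) (min_le_left _ _)
        (min_le_right _ _) x
  · by_contra! h
    refine notMem_spectrum_of_bound hS (ε := c / 8) (by positivity) (fun x => ?_) hr
    have b1 := bound_sub_smul hT hc (r := r) (δ := c / 4) (by positivity) (by linarith [h.1])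
      (by linarith [h.2]) x
    have b2 : ‖(S - T) x‖ ≤ c / 8 * ‖x‖ := (S - T).le_of_opNorm_le hST.le x
    have b3 : T x - r • x = (S x - r • x) - (S - T) x := by simp
    have b4 := norm_sub_le (S x - r • x) ((S - T) x)
    rw [← b3] at b4
    linarith

/-- A path of self-adjoint operators has, near a Fredholm operator, a symmetric spectral window of
finite rank whose end points avoid the spectrum and whose spectral projection is continuous. -/
theorem exists_window {X : Type*} [TopologicalSpace X] {T : X → E →L[ℂ] E}
    (hT : ∀ t, IsSelfAdjoint (T t)) (hcont : Continuous T) (t₀ : X) (hF : (T t₀).IsFredholm) :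
    ∃ a > 0, ∃ s : Set X, IsOpen s ∧ t₀ ∈ s ∧
      (∀ t ∈ s, a ∉ spectrum ℝ (T t)) ∧
      (∀ t ∈ s, FiniteDimensional ℂ (spectralSubspace (T t) (Set.Icc (-a) a))) ∧
      ContinuousOn (fun t => spectralProj (T t) (Set.Icc (-a) a)) s := by
  obtain ⟨a, ha, hgap₀, ε, hε, hgap⟩ := exists_spectral_gap (hT t₀) hF
  let f : C(ℝ, ℝ) := 1 - (ramp a (3 / 2 * a)).comp ⟨fun r => |r|, continuous_abs⟩
  have hlt : a < 3 / 2 * a := by linarith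
  have hf1 : Set.EqOn f 1 (Set.Icc (-a) a) := fun r hr => by
    simp [f, ramp_of_le hlt (abs_le.2 hr)]
  have hf0 : ∀ r, 3 / 2 * a ≤ |r| → f r = 0 := fun r hr => by
    simp [f, ramp_of_ge hlt hr]
  have hfcont : Continuous fun t => (cfc (f : ℝ → ℝ) (T t) : E →L[ℂ] E) :=
    hcont.cfc_of_mem_nhdsSet (s := Set.univ) (f : ℝ → ℝ) (by simp) hT
  have hproj : ∀ t, ‖T t - T t₀‖ < ε →
      spectralProj (T t) (Set.Icc (-a) a) = cfc (f : ℝ → ℝ) (T t) := fun t ht =>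
    spectralProj_eq_cfc (hT t) f hf1 fun r hr hra => by
      rcases hgap _ (hT t) ht r hr with h | h
      · exact absurd (abs_le.1 h.le) hra
      · exact hf0 r h.le
  -- On the spectrum of `T t₀` the function `r * f r` vanishes. So `f(T t₀)` has finite rank, which
  -- passes to nearby parameters by norm-closeness.
  have hker : ∀ x, (cfc (f : ℝ → ℝ) (T t₀) : E →L[ℂ] E) x ∈ (T t₀).ker := by
    intro x
    have h1 : T t₀ * cfc (f : ℝ → ℝ) (T t₀) = 0 := by
      have h2 := cfc_mul (fun r : ℝ => r) (f : ℝ → ℝ) (T t₀)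
      rw [cfc_id' ℝ (T t₀)] at h2
      rw [← h2, ← cfc_const_zero ℝ (T t₀)]
      refine cfc_congr fun r hr => ?_
      rcases lt_or_ge |r| (2 * a) with h | h
      · simp [hgap₀ r hr h]
      · simp [hf0 r (by linarith)]
    exact congrArg (fun S : E →L[ℂ] E => S x) h1
  have := hF.finite_ker
  refine ⟨a, ha, {t | ‖T t - T t₀‖ < ε ∧
    ‖(cfc (f : ℝ → ℝ) (T t) : E →L[ℂ] E) - cfc (f : ℝ → ℝ) (T t₀)‖ < 1}, ?_, ?_, ?_, ?_, ?_⟩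
  · exact (isOpen_lt (hcont.sub continuous_const).norm continuous_const).inter
      (isOpen_lt (hfcont.sub continuous_const).norm continuous_const)
  · simp [hε]
  · intro t ht hr
    rcases hgap _ (hT t) ht.1 a hr with h | h <;> rw [abs_of_pos ha] at h <;> linarith
  · intro t ht
    exact finiteDimensional_of_norm_sub_lt_one
      (fun x hx => cfc_apply_eq_self (hT t) f hf1 hx) hker ht.2
  · exact hfcont.continuousOn.congr fun t ht => hproj t ht.1

end Fredholm

/-- The grid with columns `[k / n, (k + 1) / n]` of one cell each, of prescribed heights. -/
def uniformGrid (n : ℕ) (hn : 0 < n) (a : Fin n → ℝ) (ha : ∀ k, 0 < a k) : Grid where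
  n := n
  t k := ⟨k / n, by positivity, div_le_one_of_le₀ (by exact_mod_cast k.is_le) (by positivity)⟩
  t_strictMono k l hkl := by
    have : (0 : ℝ) < n := by exact_mod_cast hn
    have : ((k : ℕ) : ℝ) < (l : ℕ) := by exact_mod_cast hkl
    exact Subtype.mk_lt_mk.2 (by gcongr)
  t_zero := by ext; simp
  t_last := by
    ext
    have : (n : ℝ) ≠ 0 := by exact_mod_cast hn.ne'
    simp [this]
  m _ := 1
  m_pos _ := one_pos
  y k := ![0, a k]
  y_strictMono k := by
    rw [Fin.strictMono_iff_lt_succ]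
    intro i
    fin_cases i
    simpa using ha k
  y_zero _ := rfl

/-! ### Existence of a good grid -/

namespace Grid

variable {H : Type*} [Group H] [TopologicalSpace H] [IsTopologicalGroup H] [CompactSpace H]
  [MeasurableSpace H] [BorelSpace H]
variable {V : Type*} [NormedAddCommGroup V] [InnerProductSpace ℂ V] [CompleteSpace V]

theorem exists_isGood (B : C(I, FredStar H V)) : ∃ G : Grid, G.IsGood B := by
  have hB : Continuous fun t => (B t : HilbL2 H V →L[ℂ] HilbL2 H V) :=
    continuous_subtype_val.comp B.continuous
  choose a ha s hs hmem hspec hfin hproj using fun t₀ : I =>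
    exists_window (fun t => (B t).2.1) hB t₀ (B t₀).2.2.1
  obtain ⟨δ, hδ, hball⟩ := lebesgue_number_lemma_of_metric (s := Set.univ) isCompact_univ hs
    fun t _ => Set.mem_iUnion.2 ⟨t, hmem t⟩
  -- Columns of width `1 / (n + 1) < δ` lie in the `δ`-ball about their left end, hence in a single
  -- window.
  obtain ⟨n, hn⟩ := exists_nat_one_div_lt hδ
  let left (k : Fin (n + 1)) : I := ⟨k / (n + 1 : ℕ), by positivity,
    div_le_one_of_le₀ (by exact_mod_cast k.is_lt.le) (by positivity)⟩
  choose c hc using fun k => hball (left k) (Set.mem_univ _)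
  let G := uniformGrid (n + 1) n.succ_pos (fun k => a (c k)) (fun k => ha _)
  have hcol : ∀ k : Fin (n + 1), Set.Icc (G.t k.castSucc) (G.t k.succ) ⊆ s (c k) := by
    intro k x hx
    apply hc k
    have h1 : (k : ℝ) / (n + 1 : ℕ) ≤ x := hx.1
    have h2 : (x : ℝ) ≤ ((k : ℕ) + 1 : ℕ) / (n + 1 : ℕ) := hx.2
    rw [Metric.mem_ball, Subtype.dist_eq, Real.dist_eq]
    change |(x : ℝ) - (k : ℝ) / (n + 1 : ℕ)| < δ
    rw [abs_of_nonneg (by linarith)]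
    push_cast at *
    rw [add_div] at h2
    linarith
  have hheight : ∀ k : Fin (n + 1), G.height k = a (c k) := fun k => rfl
  refine ⟨G, fun k i hi => ?_, fun k => ?_⟩
  · have hy : G.y k i = a (c k) := by
      change Fin 2 at i
      fin_cases i
      · exact absurd rfl hi
      · rfl
    rw [hy]
    exact ⟨hspec _ _ (hcol k (Set.left_mem_Icc.2 (G.t_castSucc_le_succ k))),
      hspec _ _ (hcol k (Set.right_mem_Icc.2 (G.t_castSucc_le_succ k)))⟩
  · rw [hheight k]
    exact ⟨fun t ht => hfin _ t (hcol k ht), (hproj _).mono (hcol k)⟩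

end Grid

end EquivSF

end

theorem mainTheorem8
    {H : Type*} [Group H] [TopologicalSpace H] [IsTopologicalGroup H] [CompactSpace H] [T2Space H]
    [MeasurableSpace H] [BorelSpace H]
    {V : Type*} [NormedAddCommGroup V] [InnerProductSpace ℂ V] [CompleteSpace V]
    [SeparableSpace V]
    (h : H) (B : C(I, EquivSF.FredStar H V)) :
    (∃ G : EquivSF.Grid, G.IsGood B) ∧
    (∀ G G' : EquivSF.Grid, G.IsGood B → G'.Refines G → G'.NonsingularAtVertices B →
      G'.IsGood B ∧ G'.traceSum h B = G.traceSum h B) ∧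
    (∀ G : EquivSF.Grid, G.IsGood B → G.traceSum h B = EquivSF.spectralFlow h B) := by
  have hex := EquivSF.Grid.exists_isGood B
  refine ⟨hex, fun G G' hG hr hns => ?_, fun G hG => ?_⟩
  · have hG' := hG.of_refines hr hns
    exact ⟨hG', EquivSF.Grid.traceSum_eq_of_isGood h hG' hG⟩
  · rw [EquivSF.spectralFlow, dif_pos hex]
    exact EquivSF.Grid.traceSum_eq_of_isGood h hG hex.choose_spec
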